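/- All Hilbert spaces and $C^*$-algebras are complex. An element $A$ of a unital $C^*$-algebra is strictly positive if $A\ge 0$ and $A$ is invertible. For strictly positive $A,B$ put $A\nabla B=\frac{A+B}{2}$ and $A\sharp B=B^{1/2}\left(B^{-1/2}AB^{-1/2}\right)^{1/2}B^{1/2}$. Let $f:(0,\infty)\to(0,\infty)$ be continuous, and let $g(A,B)=B^{1/2}f\left(B^{-1/2}AB^{-1/2}\right)B^{1/2}$ be its perspective. The function $f$ is called operator log-convex if $f(A\nabla B)\le f(A)\,\sharp\, f(B)$ for all strictly positive bounded operators $A,B$ on any Hilbert space. Then $f$ is operator log-convex if and only if $$g\left(\int_T\Phi_t(A_t\nabla C_t)\,d\mu(t),\int_T\Phi_t(B_t)\,d\mu(t)\right)\le\left(\int_T\Phi_t(g(A_t,B_t))\,d\mu(t)\right)\sharp\left(\int_T\Phi_t(g(C_t,B_t))\,d\mu(t)\right)$$ for all locally compact Hausdorff spaces $T$ with a bounded Radon measure $\mu$, all unital $C^*$-algebras $\mathfrak A,\mathfrak B$, all unital fields $(\Phi_t)_{t\in T}$ of positive linear maps $\mathfrak A\to\mathfrak B$ (that is, $t\mapsto\Phi_t(X)$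 is norm continuous for every $X\in\mathfrak A$, and $t\mapsto\Phi_t(I)$ is Bochner integrable with $\int_T\Phi_t(I)\,d\mu(t)=I$), and all norm continuous fields $(A_t)_{t\in T},(B_t)_{t\in T},(C_t)_{t\in T}$ of strictly positive elements of $\mathfrak A$ for which the four integrands in the inequality are Bochner integrable. -/

import Mathlib

open MeasureTheory

universe u v

noncomputable section

/-- The arithmetic mean `A ∇ B = (A + B) / 2`. -/
def arithMean {𝔄 : Type*} [CStarAlgebra 𝔄] (A B : 𝔄) : 𝔄 :=
  (2⁻¹ : ℝ) • (A + B)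

/-- The geometric mean `A ♯ B = B^{1/2} (B^{-1/2} A B^{-1/2})^{1/2} B^{1/2}`
of strictly positive elements. -/
def geomMean {𝔄 : Type*} [CStarAlgebra 𝔄] [PartialOrder 𝔄] [StarOrderedRing 𝔄]
    (A B : 𝔄) : 𝔄 :=
  B ^ (1 / 2 : ℝ) * (B ^ (-(1 / 2) : ℝ) * A * B ^ (-(1 / 2) : ℝ)) ^ (1 / 2 : ℝ) *
    B ^ (1 / 2 : ℝ)

/-- The perspective `g(A, B) = B^{1/2} f(B^{-1/2} A B^{-1/2}) B^{1/2}` of `f`,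
for strictly positive `A` and `B`. -/
def perspective {𝔄 : Type*} [CStarAlgebra 𝔄] [PartialOrder 𝔄] [StarOrderedRing 𝔄]
    (f : ℝ → ℝ) (A B : 𝔄) : 𝔄 :=
  B ^ (1 / 2 : ℝ) * cfc f (B ^ (-(1 / 2) : ℝ) * A * B ^ (-(1 / 2) : ℝ)) * B ^ (1 / 2 : ℝ)

/-- `f` is operator log-convex on `(0, ∞)`: `f(A ∇ B) ≤ f(A) ♯ f(B)` for all strictly positive
bounded operators `A`, `B` on an arbitrary complex Hilbert space. -/
def OperatorLogConvex (f : ℝ → ℝ) : Prop :=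
  ∀ (H : Type u) [NormedAddCommGroup H] [InnerProductSpace ℂ H] [CompleteSpace H]
    (A B : H →L[ℂ] H), IsStrictlyPositive A → IsStrictlyPositive B →
      cfc f (arithMean A B) ≤ geomMean (cfc f A) (cfc f B)

/-- A continuous field of strictly positive elements of `𝔄`. -/
structure IsStrictlyPositiveField {T 𝔄 : Type*} [TopologicalSpace T] [CStarAlgebra 𝔄]
    [PartialOrder 𝔄] (A : T → 𝔄) : Prop where
  continuous : Continuous A
  isStrictlyPositive : ∀ t, IsStrictlyPositive (A t)

/-- A unital (continuous) field `(Φ_t)` of positive linear maps `𝔄 → 𝔅`: each `t ↦ Φ_t(a)` is norm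
continuous, and `t ↦ Φ_t(1)` is Bochner integrable with integral `1`. -/
structure IsUnitalField {T 𝔄 𝔅 : Type*} [TopologicalSpace T] [MeasurableSpace T]
    [CStarAlgebra 𝔄] [PartialOrder 𝔄] [CStarAlgebra 𝔅] [PartialOrder 𝔅]
    (μ : Measure T) (Φ : T → 𝔄 →ₚ[ℂ] 𝔅) : Prop where
  continuous : ∀ a : 𝔄, Continuous fun t => Φ t a
  integrable_one : Integrable (fun t => Φ t 1) μ
  integral_one : ∫ t, Φ t 1 ∂μ = 1

end

/-! For strictly positive A and B, the mean A ♯ B is the unique nonnegative solution of X B⁻¹ X = A.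
Hence it is symmetric, monotone in both arguments and compatible with congruence. As A ♯ B ≤ A ∇ B,
log-convexity makes f operator midpoint convex. GNS representations detect the order, so both
inequalities pass from Hilbert spaces to C⋆-algebras.

Midpoint convexity yields Jensen's inequality. For an isometry V, averaging over the reflection 2VV*
- 1 gives f(V*DV) ≤ V* f(D) V. With D diagonal and V the column of square roots of positive P_i
summing to 1, this reads f(∑ x_i P_i) ≤ ∑ f(x_i) P_i. Taking P_i = ∫_K Φ_t(w_i(A_t)), for a
partition of unity w_i and a large compact K, and passing to the limit gives f(∫ Φ_t(A_t)) ≤ ∫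
Φ_t(f(A_t)) (`OperatorLogConvex.cfc_integral_le`). Each Φ_t meets only functions of the single
element A_t, so complete positivity is not needed.

For the perspective, put M = ∫ Φ_t(B_t). The maps X ↦ M^{-1/2} Φ_t(B_t^{1/2} X B_t^{1/2}) M^{-1/2}
again form a unital field. Jensen for this field, log-convexity at the two averages, monotonicity of
♯ and congruence by M^{1/2} give the inequality. Conversely, a one-point T, the identity map and B =
1 return log-convexity. -/

/-! ### The geometric mean through its Riccati equation -/

section GeometricMean

variable {𝔄 : Type*} [CStarAlgebra 𝔄] [PartialOrder 𝔄] [StarOrderedRing 𝔄]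

lemma rpow_half_mul_rpow_half {B : 𝔄} (hB : IsStrictlyPositive B) :
    B ^ (1 / 2 : ℝ) * B ^ (1 / 2 : ℝ) = B := by
  rw [← CFC.rpow_add hB.isUnit]
  norm_num
  exact CFC.rpow_one B hB.nonneg

lemma rpow_half_mul_rpow_neg_half {B : 𝔄} (hB : IsStrictlyPositive B) :
    B ^ (1 / 2 : ℝ) * B ^ (-(1 / 2) : ℝ) = 1 :=
  CFC.rpow_mul_rpow_neg _ hB

lemma rpow_neg_half_mul_rpow_half {B : 𝔄} (hB : IsStrictlyPositive B) :
    B ^ (-(1 / 2) : ℝ) * B ^ (1 / 2 : ℝ) = 1 :=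
  CFC.rpow_neg_mul_rpow _ hB

lemma rpow_neg_half_mul_rpow_neg_half {B : 𝔄} (hB : IsStrictlyPositive B) :
    B ^ (-(1 / 2) : ℝ) * B ^ (-(1 / 2) : ℝ) = Ring.inverse B := by
  rw [← CFC.rpow_add hB.isUnit, CFC.inverse_eq_rpow_neg_one hB]
  norm_num

lemma isSelfAdjoint_rpow (B : 𝔄) (x : ℝ) : IsSelfAdjoint (B ^ x) :=
  .of_nonneg CFC.rpow_nonneg

lemma isStrictlyPositive_rpow_conjugate {A B : 𝔄} (hA : IsStrictlyPositive A)
    (hB : IsStrictlyPositive B) (x : ℝ) : IsStrictlyPositive (B ^ x * A * B ^ x) :=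
  .conjugate_of_isUnit_of_isSelfAdjoint _ _ (IsStrictlyPositive.rpow B x hB).isUnit
    (isSelfAdjoint_rpow B x) hA

lemma isStrictlyPositive_geomMean {A B : 𝔄} (hA : IsStrictlyPositive A)
    (hB : IsStrictlyPositive B) : IsStrictlyPositive (geomMean A B) :=
  isStrictlyPositive_rpow_conjugate
    (IsStrictlyPositive.rpow _ _ (isStrictlyPositive_rpow_conjugate hA hB _)) hB _

/-- `A ♯ B` solves the Riccati equation `X B⁻¹ X = A`. -/
lemma geomMean_mul_inverse_mul_geomMean {A B : 𝔄} (hA : IsStrictlyPositive A)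
    (hB : IsStrictlyPositive B) :
    geomMean A B * Ring.inverse B * geomMean A B = A := by
  have h := rpow_half_mul_rpow_half (isStrictlyPositive_rpow_conjugate hA hB (-(1 / 2)))
  have h1 := rpow_half_mul_rpow_neg_half hB
  have h2 := rpow_neg_half_mul_rpow_half hB
  rw [← rpow_neg_half_mul_rpow_neg_half hB, geomMean]
  generalize (B ^ (-(1 / 2) : ℝ) * A * B ^ (-(1 / 2) : ℝ)) ^ (1 / 2 : ℝ) = Z at *
  generalize B ^ (1 / 2 : ℝ) = b at *
  generalize B ^ (-(1 / 2) : ℝ) = c at *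
  calc b * Z * b * (c * c) * (b * Z * b) = b * Z * (b * c) * (c * b) * Z * b := by
        noncomm_ring
    _ = b * (Z * Z) * b := by rw [h1, h2]; noncomm_ring
    _ = (b * c) * A * (c * b) := by rw [h]; noncomm_ring
    _ = A := by rw [h1, h2]; simp

/-- The geometric mean is the only nonnegative solution of the Riccati equation. -/
lemma geomMean_eq_of_mul_inverse_mul {A B X : 𝔄} (hB : IsStrictlyPositive B) (hX : 0 ≤ X)
    (h : X * Ring.inverse B * X = A) : geomMean A B = X := by
  have h1 := rpow_half_mul_rpow_neg_half hB
  have h2 := rpow_neg_half_mul_rpow_half hB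
  have hc := isSelfAdjoint_rpow B (-(1 / 2))
  rw [← rpow_neg_half_mul_rpow_neg_half hB] at h
  rw [geomMean]
  generalize B ^ (1 / 2 : ℝ) = b at *
  generalize B ^ (-(1 / 2) : ℝ) = c at *
  have hZ : (c * A * c) ^ (1 / 2 : ℝ) = c * X * c := by
    rw [← CFC.sqrt_eq_rpow]
    refine CFC.sqrt_unique ?_ (hc.conjugate_nonneg hX)
    rw [← h]; noncomm_ring
  calc b * (c * A * c) ^ (1 / 2 : ℝ) * b = (b * c) * X * (c * b) := by rw [hZ]; noncomm_ring
    _ = X := by rw [h1, h2]; simp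

/-- Inverting X B⁻¹ X = A turns it into X A⁻¹ X = B, and nonnegative solutions are unique. -/
lemma geomMean_comm {A B : 𝔄} (hA : IsStrictlyPositive A) (hB : IsStrictlyPositive B) :
    geomMean A B = geomMean B A := by
  have hX := isStrictlyPositive_geomMean hA hB
  refine (geomMean_eq_of_mul_inverse_mul hA hX.nonneg ?_).symm
  have h := geomMean_mul_inverse_mul_geomMean hA hB
  generalize geomMean A B = X at *
  obtain ⟨x, rfl⟩ := hX.isUnit
  obtain ⟨b, rfl⟩ := hB.isUnit
  obtain ⟨a, rfl⟩ := hA.isUnit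
  simp only [Ring.inverse_unit] at *
  norm_cast at *
  rw [← h]; group

/-- The geometric mean is invariant under congruence by self-adjoint invertible elements. -/
lemma geomMean_conjugate {A B S : 𝔄} (hA : IsStrictlyPositive A) (hB : IsStrictlyPositive B)
    (hS : IsSelfAdjoint S) (hSu : IsUnit S) :
    geomMean (S * A * S) (S * B * S) = S * geomMean A B * S := by
  have hX := isStrictlyPositive_geomMean hA hB
  refine geomMean_eq_of_mul_inverse_mul
    (.conjugate_of_isUnit_of_isSelfAdjoint _ _ hSu hS hB) (hS.conjugate_nonneg hX.nonneg) ?_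
  have h := geomMean_mul_inverse_mul_geomMean hA hB
  generalize geomMean A B = X at *
  obtain ⟨x, rfl⟩ := hX.isUnit
  obtain ⟨b, rfl⟩ := hB.isUnit
  obtain ⟨a, rfl⟩ := hA.isUnit
  obtain ⟨s, rfl⟩ := hSu
  simp only [← Units.val_mul, Ring.inverse_unit] at *
  norm_cast at *
  rw [← h]; group

lemma geomMean_mono_left {A A' B : 𝔄} (hA : A ≤ A') : geomMean A B ≤ geomMean A' B :=
  (isSelfAdjoint_rpow B _).conjugate_le_conjugate
    (CFC.rpow_le_rpow (by norm_num) ((isSelfAdjoint_rpow B _).conjugate_le_conjugate hA))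

/-- Monotonicity in the left argument is visible in the formula; symmetry transfers it to the right
one. -/
lemma geomMean_mono {A A' B B' : 𝔄} (hA : IsStrictlyPositive A) (hB : IsStrictlyPositive B)
    (hAA' : A ≤ A') (hBB' : B ≤ B') : geomMean A B ≤ geomMean A' B' := by
  have hA' := hA.of_le hAA'
  calc geomMean A B ≤ geomMean A' B := geomMean_mono_left hAA'
    _ = geomMean B A' := geomMean_comm hA' hB
    _ ≤ geomMean B' A' := geomMean_mono_left hBB'
    _ = geomMean A' B' := geomMean_comm (hB.of_le hBB') hA'

/-- The inequality between the geometric and the arithmetic mean. -/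
lemma geomMean_le_arithMean {A B : 𝔄} (hA : IsStrictlyPositive A) (hB : IsStrictlyPositive B) :
    geomMean A B ≤ arithMean A B := by
  have hC := isStrictlyPositive_rpow_conjugate hA hB (-(1 / 2))
  have hZ := rpow_half_mul_rpow_half hC
  have h1 := rpow_half_mul_rpow_neg_half hB
  have h2 := rpow_neg_half_mul_rpow_half hB
  have h3 := rpow_half_mul_rpow_half hB
  have hZs := isSelfAdjoint_rpow (B ^ (-(1 / 2) : ℝ) * A * B ^ (-(1 / 2) : ℝ)) (1 / 2)
  have hbs := isSelfAdjoint_rpow B (1 / 2)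
  rw [geomMean, arithMean]
  generalize (B ^ (-(1 / 2) : ℝ) * A * B ^ (-(1 / 2) : ℝ)) ^ (1 / 2 : ℝ) = Z at *
  generalize B ^ (1 / 2 : ℝ) = b at *
  generalize B ^ (-(1 / 2) : ℝ) = c at *
  -- The gap A ∇ B - A ♯ B equals b · ½(Z - 1)² · b.
  have h0 : 0 ≤ (Z - 1) * (Z - 1) := (hZs.sub (.one 𝔄)).mul_self_nonneg
  have h4 := hbs.conjugate_nonneg (smul_nonneg (by norm_num : (0 : ℝ) ≤ 2⁻¹) h0)
  rw [← sub_nonneg]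
  convert h4 using 1
  have : A = b * (Z * Z) * b := by
    rw [hZ]
    calc A = (b * c) * A * (c * b) := by rw [h1, h2]; simp
      _ = _ := by noncomm_ring
  rw [this, ← h3]
  have e : (Z - 1) * (Z - 1) = Z * Z + 1 - (2 : ℝ) • Z := by rw [two_smul]; noncomm_ring
  rw [e]
  simp only [smul_sub, smul_add, mul_sub, sub_mul, mul_add, add_mul, smul_smul, mul_smul_comm,
    smul_mul_assoc, mul_one]
  norm_num

lemma isStrictlyPositive_arithMean {A B : 𝔄} (hA : IsStrictlyPositive A)
    (hB : IsStrictlyPositive B) : IsStrictlyPositive (arithMean A B) :=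
  .smul (by norm_num) (isStrictlyPositive_add (.inl ⟨hA, hB.nonneg⟩))

lemma isStrictlyPositive_cfc {f : ℝ → ℝ} (hf : ContinuousOn f (Set.Ioi 0))
    (hpos : ∀ x : ℝ, 0 < x → 0 < f x) {A : 𝔄} (hA : IsStrictlyPositive A) :
    IsStrictlyPositive (cfc f A) := by
  have hs : spectrum ℝ A ⊆ Set.Ioi 0 := fun x hx => hA.spectrum_pos hx
  refine IsUnit.isStrictlyPositive ?_ (cfc_nonneg fun x hx => (hpos x (hs hx)).le)
  rw [isUnit_cfc_iff f A (hf.mono hs)]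
  exact fun x hx => (hpos x (hs hx)).ne'

end GeometricMean

/-! ### States, representations and the passage to C⋆-algebras -/

section States

open scoped ComplexOrder ComplexStarModule InnerProductSpace

variable {𝔅 : Type*} [CStarAlgebra 𝔅] [PartialOrder 𝔅] [StarOrderedRing 𝔅]

/-- Positive functionals detect positivity of self-adjoint elements. -/
lemma nonneg_of_forall_positiveLinearMap_nonneg {b : 𝔅} (hb : IsSelfAdjoint b)
    (h : ∀ φ : 𝔅 →ₚ[ℂ] ℂ, 0 ≤ φ b) : 0 ≤ b := by
  by_contra hb0
  -- The positive cone is closed and convex, so a real functional nonnegative on it is negative at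
  -- `b`.
  obtain ⟨f, hf, hfb⟩ := (ProperCone.positive ℝ 𝔅).hyperplane_separation_point (x₀ := b) hb0
  -- Precomposing with the real part makes the complex extension of `g` agree with `f` on
  -- self-adjoint elements.
  let g : Module.Dual ℝ 𝔅 :=
    f.toLinearMap ∘ₗ (selfAdjoint.submodule ℝ 𝔅).subtype ∘ₗ realPart
  have hg : ∀ a : 𝔅, IsSelfAdjoint a → g.extendRCLike (𝕜 := ℂ) a = (f a : ℂ) := by
    intro a ha
    rw [Module.Dual.extendRCLike_apply]
    have h1 : g a = f a := congrArg f ha.coe_realPart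
    have h2 : g ((RCLike.I : ℂ) • a) = 0 := by
      have : realPart ((RCLike.I : ℂ) • a) = 0 := by
        simp [realPart_I_smul, ha.imaginaryPart]
      change f ((realPart ((RCLike.I : ℂ) • a) : selfAdjoint 𝔅) : 𝔅) = 0
      rw [this]
      simp
    rw [h1, h2]
    simp
  let φ : 𝔅 →ₚ[ℂ] ℂ := PositiveLinearMap.mk₀ (g.extendRCLike (𝕜 := ℂ)) (fun a ha => by
    rw [hg a (.of_nonneg ha)]
    exact_mod_cast hf a ha)
  have h1 : 0 ≤ (f b : ℂ) := by
    rw [← hg b hb]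
    exact h φ
  exact absurd (by exact_mod_cast h1 : 0 ≤ f b) (not_le.2 hfb)

/-- φ(b) is the vector functional ⟨Ω, π(b)Ω⟩ at the class Ω of 1. -/
lemma PositiveLinearMap.nonneg_of_gnsStarAlgHom_nonneg (φ : 𝔅 →ₚ[ℂ] ℂ) {b : 𝔅}
    (h : 0 ≤ φ.gnsStarAlgHom b) : 0 ≤ φ b := by
  rw [ContinuousLinearMap.nonneg_iff_isPositive] at h
  have h1 := h.inner_nonneg_right (φ.toPreGNS 1 : φ.GNS)
  have h2 : φ.gnsStarAlgHom b (φ.toPreGNS 1 : φ.GNS) =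
      (φ.leftMulMapPreGNS b (φ.toPreGNS 1) : φ.GNS) :=
    φ.gnsNonUnitalStarAlgHom_apply_coe
  rw [h2, UniformSpace.Completion.inner_coe, PositiveLinearMap.preGNS_inner_def] at h1
  simpa using h1

/-- The order of a C⋆-algebra is determined by its GNS representations. -/
lemma le_of_forall_gnsStarAlgHom_le {a b : 𝔅} (ha : IsSelfAdjoint a) (hb : IsSelfAdjoint b)
    (h : ∀ φ : 𝔅 →ₚ[ℂ] ℂ, φ.gnsStarAlgHom a ≤ φ.gnsStarAlgHom b) : a ≤ b := by
  rw [← sub_nonneg]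
  refine nonneg_of_forall_positiveLinearMap_nonneg (hb.sub ha) fun φ => ?_
  refine φ.nonneg_of_gnsStarAlgHom_nonneg ?_
  rw [map_sub]
  exact sub_nonneg.2 (h φ)

end States

section StarAlgHom

variable {𝔄 𝔅 : Type*} [CStarAlgebra 𝔄] [PartialOrder 𝔄] [StarOrderedRing 𝔄]
  [CStarAlgebra 𝔅] [PartialOrder 𝔅] [StarOrderedRing 𝔅] (π : 𝔄 →⋆ₐ[ℂ] 𝔅)

lemma StarAlgHom.map_isStrictlyPositive {A : 𝔄} (hA : IsStrictlyPositive A) :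
    IsStrictlyPositive (π A) :=
  (hA.isUnit.map π).isStrictlyPositive (map_nonneg π hA.nonneg)

lemma StarAlgHom.map_cfc_of_isStrictlyPositive {f : ℝ → ℝ} (hf : ContinuousOn f (Set.Ioi 0))
    {A : 𝔄} (hA : IsStrictlyPositive A) : π (cfc f A) = cfc f (π A) :=
  π.map_cfc f A (hf.mono fun _ hx => hA.spectrum_pos hx) (map_continuous π) hA.isSelfAdjoint
    (π.map_isStrictlyPositive hA).isSelfAdjoint

lemma StarAlgHom.map_arithMean (A B : 𝔄) : π (arithMean A B) = arithMean (π A) (π B) := by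
  simp only [arithMean, ← Complex.coe_smul, map_smul, map_add]

/-- A ⋆-homomorphism preserves the Riccati equation, so uniqueness of its solution applies. -/
lemma StarAlgHom.map_geomMean {A B : 𝔄} (hA : IsStrictlyPositive A) (hB : IsStrictlyPositive B) :
    π (geomMean A B) = geomMean (π A) (π B) := by
  refine (geomMean_eq_of_mul_inverse_mul (π.map_isStrictlyPositive hB)
    (map_nonneg π (isStrictlyPositive_geomMean hA hB).nonneg) ?_).symm
  have h : π (Ring.inverse B) = Ring.inverse (π B) := by
    obtain ⟨b, rfl⟩ := hB.isUnit
    have : π (b : 𝔄) = (Units.map (π : 𝔄 →* 𝔅) b : 𝔅) := rfl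
    rw [this, Ring.inverse_unit, Ring.inverse_unit]
    rfl
  rw [← h, ← map_mul, ← map_mul, geomMean_mul_inverse_mul_geomMean hA hB]

end StarAlgHom

/-- Operator log-convexity passes from operators on Hilbert spaces to elements of C⋆-algebras. -/
lemma OperatorLogConvex.cfc_arithMean_le {f : ℝ → ℝ} (hf : ContinuousOn f (Set.Ioi 0))
    (hpos : ∀ x : ℝ, 0 < x → 0 < f x) (h : OperatorLogConvex.{u} f)
    {𝔅 : Type u} [CStarAlgebra 𝔅] [PartialOrder 𝔅] [StarOrderedRing 𝔅] {A B : 𝔅}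
    (hA : IsStrictlyPositive A) (hB : IsStrictlyPositive B) :
    cfc f (arithMean A B) ≤ geomMean (cfc f A) (cfc f B) := by
  have hfA := isStrictlyPositive_cfc hf hpos hA
  have hfB := isStrictlyPositive_cfc hf hpos hB
  refine le_of_forall_gnsStarAlgHom_le (cfc_predicate f _)
    (isStrictlyPositive_geomMean hfA hfB).isSelfAdjoint fun φ => ?_
  rw [StarAlgHom.map_geomMean _ hfA hfB,
    StarAlgHom.map_cfc_of_isStrictlyPositive _ hf (isStrictlyPositive_arithMean hA hB),
    StarAlgHom.map_cfc_of_isStrictlyPositive _ hf hA,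
    StarAlgHom.map_cfc_of_isStrictlyPositive _ hf hB, StarAlgHom.map_arithMean]
  exact h _ _ _ (StarAlgHom.map_isStrictlyPositive _ hA) (StarAlgHom.map_isStrictlyPositive _ hB)

/-- An operator log-convex function is operator midpoint convex. -/
lemma OperatorLogConvex.cfc_arithMean_le_arithMean {f : ℝ → ℝ} (hf : ContinuousOn f (Set.Ioi 0))
    (hpos : ∀ x : ℝ, 0 < x → 0 < f x) (h : OperatorLogConvex.{u} f)
    {𝔅 : Type u} [CStarAlgebra 𝔅] [PartialOrder 𝔅] [StarOrderedRing 𝔅] {A B : 𝔅}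
    (hA : IsStrictlyPositive A) (hB : IsStrictlyPositive B) :
    cfc f (arithMean A B) ≤ arithMean (cfc f A) (cfc f B) :=
  (h.cfc_arithMean_le hf hpos hA hB).trans
    (geomMean_le_arithMean (isStrictlyPositive_cfc hf hpos hA) (isStrictlyPositive_cfc hf hpos hB))

/-! ### Scalar bounds and spectra -/

section SpectralBounds

variable {𝔄 : Type*} [CStarAlgebra 𝔄] [PartialOrder 𝔄] [StarOrderedRing 𝔄]

lemma IsStrictlyPositive.exists_pos_algebraMap_le {A : 𝔄} (hA : IsStrictlyPositive A) :
    ∃ r : ℝ, 0 < r ∧ algebraMap ℝ 𝔄 r ≤ A := by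
  cases subsingleton_or_nontrivial 𝔄
  · exact ⟨1, one_pos, (Subsingleton.elim _ _).le⟩
  · exact (CFC.exists_pos_algebraMap_le_iff hA.isSelfAdjoint).2 fun x hx => hA.spectrum_pos hx

lemma isStrictlyPositive_of_algebraMap_le {A : 𝔄} {r : ℝ} (hr : 0 < r)
    (h : algebraMap ℝ 𝔄 r ≤ A) : IsStrictlyPositive A :=
  (isStrictlyPositive_algebraMap hr).of_le h

lemma spectrum_subset_Icc {A : 𝔄} (hA : IsSelfAdjoint A) {r s : ℝ} (hr : algebraMap ℝ 𝔄 r ≤ A)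
    (hs : A ≤ algebraMap ℝ 𝔄 s) : spectrum ℝ A ⊆ Set.Icc r s := fun x hx =>
  ⟨(algebraMap_le_iff_le_spectrum hA).1 hr x hx, (le_algebraMap_iff_spectrum_le hA).1 hs x hx⟩

lemma IsStrictlyPositive.exists_spectrum_subset_Icc {A : 𝔄} (hA : IsStrictlyPositive A) :
    ∃ r s : ℝ, 0 < r ∧ spectrum ℝ A ⊆ Set.Icc r s := by
  obtain ⟨r, hr, hrA⟩ := hA.exists_pos_algebraMap_le
  exact ⟨r, ‖A‖, hr, spectrum_subset_Icc hA.isSelfAdjoint hrA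
    (IsSelfAdjoint.le_algebraMap_norm_self hA.isSelfAdjoint)⟩

end SpectralBounds

/-! ### Intertwiners and Jensen's inequality for an isometry -/

section Hilbert

open ContinuousLinearMap

variable {H K : Type*} [NormedAddCommGroup H] [InnerProductSpace ℂ H]
  [NormedAddCommGroup K] [InnerProductSpace ℂ K]

lemma aeval_comp_eq_comp_aeval {E : K →L[ℂ] K} {S : H →L[ℂ] H} {V : H →L[ℂ] K}
    (h : E ∘L V = V ∘L S) (p : Polynomial ℝ) :
    Polynomial.aeval E p ∘L V = V ∘L Polynomial.aeval S p := by
  induction p using Polynomial.induction_on' with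
  | add p q hp hq => rw [map_add, map_add, add_comp, comp_add, hp, hq]
  | monomial n c =>
    have hn : (E ^ n) ∘L V = V ∘L (S ^ n) := by
      induction n with
      | zero => rfl
      | succ n ih =>
        rw [pow_succ, pow_succ', mul_def, mul_def, comp_assoc, h, ← comp_assoc, ih, comp_assoc,
          ← mul_def, ← mul_def, ← pow_succ, ← pow_succ']
    rw [Polynomial.aeval_monomial, Polynomial.aeval_monomial, Algebra.algebraMap_eq_smul_one,
      Algebra.algebraMap_eq_smul_one, smul_one_mul, smul_one_mul, smul_comp, hn]
    ext x
    simp [← Complex.coe_smul]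

variable [CompleteSpace H] [CompleteSpace K]

/-- The continuous functional calculus respects intertwining operators. -/
lemma cfc_comp_eq_comp_cfc {f : ℝ → ℝ} (hf : ContinuousOn f (Set.Ioi 0)) {E : K →L[ℂ] K}
    {S : H →L[ℂ] H} {V : H →L[ℂ] K} (hE : IsStrictlyPositive E) (hS : IsStrictlyPositive S)
    (h : E ∘L V = V ∘L S) : cfc f E ∘L V = V ∘L cfc f S := by
  obtain ⟨r₁, s₁, hr₁, h₁⟩ := hE.exists_spectrum_subset_Icc
  obtain ⟨r₂, s₂, hr₂, h₂⟩ := hS.exists_spectrum_subset_Icc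
  set r := min r₁ r₂
  set s := max s₁ s₂
  have hr : 0 < r := lt_min hr₁ hr₂
  replace h₁ : spectrum ℝ E ⊆ Set.Icc r s :=
    h₁.trans (Set.Icc_subset_Icc (min_le_left _ _) (le_max_left _ _))
  replace h₂ : spectrum ℝ S ⊆ Set.Icc r s :=
    h₂.trans (Set.Icc_subset_Icc (min_le_right _ _) (le_max_right _ _))
  have hfr : ContinuousOn f (Set.Icc r s) := hf.mono fun x hx => hr.trans_le hx.1
  have key : ∀ ε : ℝ, 0 < ε → ‖cfc f E ∘L V - V ∘L cfc f S‖ ≤ ε * (2 * ‖V‖) := by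
    intro ε hε
    -- Polynomials intertwine exactly; one `p` approximates f on an interval containing both
    -- spectra.
    obtain ⟨p, hp⟩ := exists_polynomial_near_of_continuousOn r s f hfr ε hε
    have hpE : ‖Polynomial.aeval E p - cfc f E‖ ≤ ε := by
      rw [← cfc_polynomial p E hE.isSelfAdjoint,
        ← cfc_sub _ f E (by fun_prop) (hfr.mono h₁)]
      exact norm_cfc_le hε.le fun x hx => (hp x (h₁ hx)).le
    have hpS : ‖Polynomial.aeval S p - cfc f S‖ ≤ ε := by
      rw [← cfc_polynomial p S hS.isSelfAdjoint,
        ← cfc_sub _ f S (by fun_prop) (hfr.mono h₂)]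
      exact norm_cfc_le hε.le fun x hx => (hp x (h₂ hx)).le
    have e : cfc f E ∘L V - V ∘L cfc f S =
        V ∘L (Polynomial.aeval S p - cfc f S) - (Polynomial.aeval E p - cfc f E) ∘L V := by
      rw [comp_sub, sub_comp, aeval_comp_eq_comp_aeval h]
      abel
    rw [e]
    calc _ ≤ ‖V ∘L (Polynomial.aeval S p - cfc f S)‖ +
          ‖(Polynomial.aeval E p - cfc f E) ∘L V‖ := norm_sub_le _ _
      _ ≤ ‖V‖ * ε + ε * ‖V‖ := by
        gcongr
        · exact (opNorm_comp_le _ _).trans (by gcongr)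
        · exact (opNorm_comp_le _ _).trans (by gcongr)
      _ = ε * (2 * ‖V‖) := by ring
  rw [← sub_eq_zero, ← norm_le_zero_iff]
  refine ge_of_tendsto (x := nhdsWithin (0 : ℝ) (Set.Ioi 0)) (f := fun ε => ε * (2 * ‖V‖)) ?_
    (Filter.eventually_of_mem self_mem_nhdsWithin key)
  have : Filter.Tendsto (fun ε : ℝ => ε * (2 * ‖V‖)) (nhds 0) (nhds (0 * (2 * ‖V‖))) :=
    (continuous_id.mul continuous_const).tendsto 0
  rw [zero_mul] at this
  exact this.mono_left nhdsWithin_le_nhds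

lemma adjoint_comp_comp_mono {A B : K →L[ℂ] K} (h : A ≤ B) (V : H →L[ℂ] K) :
    adjoint V ∘L A ∘L V ≤ adjoint V ∘L B ∘L V := by
  rw [ContinuousLinearMap.le_def] at h ⊢
  have := h.adjoint_conj V
  rwa [sub_comp, comp_sub] at this

lemma isStrictlyPositive_adjoint_comp_comp {D : K →L[ℂ] K} (hD : IsStrictlyPositive D)
    {V : H →L[ℂ] K} (hV : adjoint V ∘L V = 1) : IsStrictlyPositive (adjoint V ∘L D ∘L V) := by
  obtain ⟨r, hr, hrD⟩ := hD.exists_pos_algebraMap_le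
  refine isStrictlyPositive_of_algebraMap_le hr ?_
  convert adjoint_comp_comp_mono hrD V using 1
  rw [Algebra.algebraMap_eq_smul_one, Algebra.algebraMap_eq_smul_one, smul_comp, ← hV]
  ext x
  simp [← Complex.coe_smul]

/-- Jensen's operator inequality for an isometry, from operator midpoint convexity. -/
lemma cfc_adjoint_comp_comp_le {f : ℝ → ℝ} (hf : ContinuousOn f (Set.Ioi 0))
    (hconv : ∀ A B : K →L[ℂ] K, IsStrictlyPositive A → IsStrictlyPositive B →
      cfc f (arithMean A B) ≤ arithMean (cfc f A) (cfc f B))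
    {D : K →L[ℂ] K} (hD : IsStrictlyPositive D) {V : H →L[ℂ] K} (hV : adjoint V ∘L V = 1) :
    cfc f (adjoint V ∘L D ∘L V) ≤ adjoint V ∘L cfc f D ∘L V := by
  have hVx : ∀ x, adjoint V (V x) = x := fun x => congrArg (· x) hV
  -- `U` is the reflection in the range of V. The mean of D and UDU is the block-diagonal part of D,
  -- which V intertwines with V*DV. Since UV = V, both f(D) and f(UDU) = U f(D) U compress to V*
  -- f(D) V.
  set U : K →L[ℂ] K := (2 : ℂ) • (V ∘L adjoint V) - 1 with hU
  have hUs : IsSelfAdjoint U := by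
    rw [IsSelfAdjoint, star_eq_adjoint, hU, map_sub, map_smulₛₗ, adjoint_comp, adjoint_adjoint,
      ← star_eq_adjoint (1 : K →L[ℂ] K), star_one, Complex.conj_ofNat]
  have hUU : U * U = 1 := by
    ext x
    simp only [hU, mul_apply_eq_comp, sub_apply, smul_apply, comp_apply, one_apply_eq_self, map_sub, map_smul, hVx]
    module
  have hUu : IsUnit U := ⟨⟨U, U, hUU, hUU⟩, rfl⟩
  have hD' : IsStrictlyPositive (U * D * U) :=
    .conjugate_of_isUnit_of_isSelfAdjoint _ _ hUu hUs hD
  have hfU : cfc f (U * D * U) = U * cfc f D * U := by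
    have h := cfc_comp_eq_comp_cfc hf hD' hD (V := U) (by
      rw [← mul_def, ← mul_def, mul_assoc, hUU, mul_one])
    rw [← mul_def, ← mul_def] at h
    rw [← h, mul_assoc (cfc f _), hUU, mul_one]
  have hE := isStrictlyPositive_arithMean hD hD'
  have hS := isStrictlyPositive_adjoint_comp_comp hD hV
  have hUV : ∀ x, U (V x) = V x := fun x => by
    simp only [hU, sub_apply, smul_apply, comp_apply, one_apply_eq_self, hVx]
    module
  have hVU : ∀ x, adjoint V (U x) = adjoint V x := fun x => by
    simp only [hU, sub_apply, smul_apply, comp_apply, one_apply_eq_self, hVx, map_sub, map_smul]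
    module
  have h1 := cfc_comp_eq_comp_cfc hf hE hS (V := V) (by
    ext x
    simp only [arithMean, ← Complex.coe_smul, comp_apply, smul_apply, add_apply, mul_apply_eq_comp, hUV]
    simp only [hU, sub_apply, smul_apply, comp_apply, one_apply_eq_self]
    push_cast
    module)
  have h2 := adjoint_comp_comp_mono (hconv _ _ hD hD') V
  rw [h1, ← comp_assoc, hV, hfU, one_def, id_comp] at h2
  refine h2.trans_eq ?_
  ext x
  simp only [arithMean, ← Complex.coe_smul, comp_apply, smul_apply, add_apply, mul_apply_eq_comp, hUV,
    map_smul, map_add, hVU]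
  push_cast
  module

end Hilbert

/-! ### Dilating finite positive partitions of the identity -/

section FiniteJensen

open ContinuousLinearMap

variable {ι : Type*} {H : Type*} [NormedAddCommGroup H] [InnerProductSpace ℂ H]

/-- The operator into a finite Hilbert sum with given components. -/
noncomputable def piLpOperator [Fintype ι] {G : Type*} [NormedAddCommGroup G] [InnerProductSpace ℂ G]
    (g : ι → G →L[ℂ] H) : G →L[ℂ] PiLp 2 (fun _ : ι => H) :=
  ((PiLp.continuousLinearEquiv 2 ℂ (fun _ : ι => H)).symm : _ →L[ℂ] _) ∘L ContinuousLinearMap.pi g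

@[simp]
lemma piLpOperator_apply [Fintype ι] {G : Type*} [NormedAddCommGroup G] [InnerProductSpace ℂ G]
    (g : ι → G →L[ℂ] H) (x : G) (i : ι) : piLpOperator g x i = g i x := rfl

variable [Fintype ι]

/-- The diagonal operator on a finite Hilbert sum with given real eigenvalues. -/
noncomputable def diagOperator (H : Type*) [NormedAddCommGroup H] [InnerProductSpace ℂ H]
    (x : ι → ℝ) : PiLp 2 (fun _ : ι => H) →L[ℂ] PiLp 2 (fun _ : ι => H) :=
  piLpOperator fun i => (x i : ℂ) • PiLp.proj 2 (fun _ : ι => H) i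

@[simp]
lemma diagOperator_apply (x : ι → ℝ) (v : PiLp 2 (fun _ : ι => H)) (i : ι) :
    diagOperator H x v i = (x i : ℂ) • v i := rfl

lemma diagOperator_mul (x y : ι → ℝ) :
    diagOperator H x * diagOperator H y = diagOperator H (x * y) := by
  ext v i
  simp [-Complex.coe_smul, mul_apply_eq_comp, smul_smul]

lemma diagOperator_one : diagOperator H (1 : ι → ℝ) = 1 := by
  ext v i
  simp

variable [CompleteSpace H]

lemma isSelfAdjoint_diagOperator (x : ι → ℝ) : IsSelfAdjoint (diagOperator H x) := by
  rw [isSelfAdjoint_iff_isSymmetric]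
  intro v w
  simp [-Complex.coe_smul, PiLp.inner_apply, inner_smul_left, inner_smul_right]

lemma isStrictlyPositive_diagOperator {x : ι → ℝ} (hx : ∀ i, 0 < x i) :
    IsStrictlyPositive (diagOperator H x) := by
  refine IsUnit.isStrictlyPositive ⟨⟨diagOperator H x, diagOperator H x⁻¹, ?_, ?_⟩, rfl⟩ ?_
  · rw [diagOperator_mul, ← diagOperator_one]
    congr 1
    ext i
    simp [(hx i).ne']
  · rw [diagOperator_mul, ← diagOperator_one]
    congr 1
    ext i
    simp [(hx i).ne']
  · have : x = (fun i => √(x i)) * (fun i => √(x i)) := by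
      ext i
      simp [(hx i).le]
    rw [this, ← diagOperator_mul]
    exact (isSelfAdjoint_diagOperator _).mul_self_nonneg

/-- Each coordinate projection intertwines the diagonal operator with a scalar. -/
lemma cfc_diagOperator_apply {f : ℝ → ℝ} (hf : ContinuousOn f (Set.Ioi 0)) {x : ι → ℝ}
    (hx : ∀ i, 0 < x i) (v : PiLp 2 (fun _ : ι => H)) (i : ι) :
    cfc f (diagOperator H x) v i = (f (x i) : ℂ) • v i := by
  have h := cfc_comp_eq_comp_cfc hf (isStrictlyPositive_algebraMap (A := H →L[ℂ] H) (hx i))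
    (isStrictlyPositive_diagOperator hx) (V := PiLp.proj 2 (fun _ : ι => H) i) (by
      ext w
      simp [Algebra.algebraMap_eq_smul_one, ← Complex.coe_smul])
  rw [cfc_algebraMap] at h
  have h' := congrArg (· v) h
  simpa [Algebra.algebraMap_eq_smul_one, ← Complex.coe_smul] using h'.symm

lemma adjoint_piLpOperator_comp_comp {ι : Type*} [Fintype ι] {R : ι → H →L[ℂ] H} {P : ι → H →L[ℂ] H}
    (hR : ∀ i, IsSelfAdjoint (R i)) (hP : ∀ i, R i * R i = P i) (x : ι → ℝ)
    {D : PiLp 2 (fun _ : ι => H) →L[ℂ] PiLp 2 (fun _ : ι => H)}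
    (hD : ∀ v i, D v i = (x i : ℂ) • v i) :
    adjoint (piLpOperator R) ∘L D ∘L piLpOperator R = ∑ i, x i • P i := by
  ext v
  refine ext_inner_left ℂ fun w => ?_
  simp only [comp_apply, adjoint_inner_right, PiLp.inner_apply, hD, piLpOperator_apply,
    ← Complex.coe_smul, sum_apply, smul_apply, inner_sum, inner_smul_right, ← hP, mul_apply_eq_comp]
  refine Finset.sum_congr rfl fun i _ => ?_
  rw [← adjoint_inner_right (R i), (hR i).adjoint_eq]

/-- The column V of the square roots of the P_i is an isometry into the Hilbert sum, and V*DV = ∑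
x_i P_i for the diagonal D. Taking `ι : Type` keeps that sum in the universe of `H`, where
log-convexity is assumed. -/
lemma OperatorLogConvex.cfc_sum_smul_le_of_hilbert {f : ℝ → ℝ}
    (hf : ContinuousOn f (Set.Ioi 0)) (hpos : ∀ x : ℝ, 0 < x → 0 < f x)
    (h : OperatorLogConvex.{u} f) {H : Type u} [NormedAddCommGroup H] [InnerProductSpace ℂ H]
    [CompleteSpace H] {ι : Type} [Fintype ι] {P : ι → H →L[ℂ] H} (hP : ∀ i, 0 ≤ P i) (hP1 : ∑ i, P i = 1) {x : ι → ℝ}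
    (hx : ∀ i, 0 < x i) : cfc f (∑ i, x i • P i) ≤ ∑ i, f (x i) • P i := by
  have hR : ∀ i, IsSelfAdjoint (CFC.sqrt (P i)) := fun i => .of_nonneg (CFC.sqrt_nonneg _)
  have hRP : ∀ i, CFC.sqrt (P i) * CFC.sqrt (P i) = P i := fun i =>
    CFC.sqrt_mul_sqrt_self (P i) (hP i)
  have hV : adjoint (piLpOperator fun i => CFC.sqrt (P i)) ∘L
      (piLpOperator fun i => CFC.sqrt (P i)) = 1 := by
    have := adjoint_piLpOperator_comp_comp hR hRP (fun _ => 1) (D := 1) (by simp)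
    simpa [hP1, one_def] using this
  have h := cfc_adjoint_comp_comp_le hf
    (fun A B hA hB => h.cfc_arithMean_le_arithMean hf hpos hA hB)
    (D := diagOperator H x) (isStrictlyPositive_diagOperator hx) hV
  rwa [adjoint_piLpOperator_comp_comp hR hRP x (diagOperator_apply x),
    adjoint_piLpOperator_comp_comp hR hRP (fun i => f (x i)) (cfc_diagOperator_apply hf hx)] at h

end FiniteJensen

lemma isStrictlyPositive_sum_smul {𝔅 : Type*} [CStarAlgebra 𝔅] [PartialOrder 𝔅]
    [StarOrderedRing 𝔅] {ι : Type*} [Fintype ι] {P : ι → 𝔅} (hP : ∀ i, 0 ≤ P i)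
    (hP1 : ∑ i, P i = 1) {x : ι → ℝ} (hx : ∀ i, 0 < x i) :
    IsStrictlyPositive (∑ i, x i • P i) := by
  obtain ⟨r, hr, hrx⟩ : ∃ r : ℝ, 0 < r ∧ ∀ i, r ≤ x i := by
    rcases isEmpty_or_nonempty ι with h | h
    · exact ⟨1, one_pos, fun i => h.elim i⟩
    · obtain ⟨i, hi⟩ := Finite.exists_min x
      exact ⟨x i, hx i, hi⟩
  refine isStrictlyPositive_of_algebraMap_le hr ?_
  rw [Algebra.algebraMap_eq_smul_one, ← hP1, Finset.smul_sum]
  exact Finset.sum_le_sum fun i _ => smul_le_smul_of_nonneg_right (hrx i) (hP i)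

/-- Jensen's inequality for finite operator-convex combinations of scalars. -/
lemma OperatorLogConvex.cfc_sum_smul_le {f : ℝ → ℝ} (hf : ContinuousOn f (Set.Ioi 0))
    (hpos : ∀ x : ℝ, 0 < x → 0 < f x) (h : OperatorLogConvex.{u} f)
    {𝔅 : Type u} [CStarAlgebra 𝔅] [PartialOrder 𝔅] [StarOrderedRing 𝔅] {ι : Type} [Fintype ι] {P : ι → 𝔅}
    (hP : ∀ i, 0 ≤ P i) (hP1 : ∑ i, P i = 1) {x : ι → ℝ} (hx : ∀ i, 0 < x i) :
    cfc f (∑ i, x i • P i) ≤ ∑ i, f (x i) • P i := by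
  refine le_of_forall_gnsStarAlgHom_le (cfc_predicate f _)
    (IsSelfAdjoint.of_nonneg (Finset.sum_nonneg fun i _ => smul_nonneg (hpos _ (hx i)).le (hP i)))
    fun φ => ?_
  have hsum : ∀ y : ι → ℝ,
      φ.gnsStarAlgHom (∑ i, y i • P i) = ∑ i, y i • φ.gnsStarAlgHom (P i) := fun y => by
    simp only [← Complex.coe_smul, map_sum, map_smul]
  rw [StarAlgHom.map_cfc_of_isStrictlyPositive _ hf (isStrictlyPositive_sum_smul hP hP1 hx),
    hsum, hsum]
  refine h.cfc_sum_smul_le_of_hilbert hf hpos (fun i => map_nonneg _ (hP i)) ?_ hx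
  rw [← map_sum, hP1, map_one]

/-! ### Continuity of the functional calculus and of fields of positive maps -/

section FunctionalCalculus

variable {𝔄 : Type*} [CStarAlgebra 𝔄] [PartialOrder 𝔄] [StarOrderedRing 𝔄]

lemma continuousOn_cfc_isStrictlyPositive {f : ℝ → ℝ} (hf : ContinuousOn f (Set.Ioi 0)) :
    ContinuousOn (fun A : 𝔄 => cfc f A) {A | IsStrictlyPositive A} := by
  refine ContinuousOn.cfc_of_mem_nhdsSet (s := Set.Ioi 0) f ?_ continuousOn_id
    (fun A hA => IsStrictlyPositive.isSelfAdjoint hA) hf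
  refine isOpen_Ioi.mem_nhdsSet.2 ?_
  simp only [Set.iUnion_subset_iff]
  exact fun A hA x hx => IsStrictlyPositive.spectrum_pos hA hx

lemma rpow_eq_cfc {A : 𝔄} (hA : 0 ≤ A) (x : ℝ) : A ^ x = cfc (fun y : ℝ => y ^ x) A :=
  CFC.rpow_eq_cfc_real hA

lemma norm_le_of_neg_algebraMap_le_of_le {A : 𝔄} (hA : IsSelfAdjoint A) {r : ℝ} (hr : 0 ≤ r)
    (h₁ : algebraMap ℝ 𝔄 (-r) ≤ A) (h₂ : A ≤ algebraMap ℝ 𝔄 r) : ‖A‖ ≤ r := by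
  cases subsingleton_or_nontrivial 𝔄
  · rwa [Subsingleton.elim A 0, norm_zero]
  · have hs := spectrum_subset_Icc hA h₁ h₂
    rcases CStarAlgebra.norm_or_neg_norm_mem_spectrum hA with h | h
    · exact (hs h).2
    · exact neg_le_neg_iff.1 (hs h).1

end FunctionalCalculus

section PositiveMaps

variable {𝔄 𝔅 : Type*} [CStarAlgebra 𝔄] [PartialOrder 𝔄] [StarOrderedRing 𝔄]
  [CStarAlgebra 𝔅] [PartialOrder 𝔅] [StarOrderedRing 𝔅]

lemma PositiveLinearMap.map_real_smul (φ : 𝔄 →ₚ[ℂ] 𝔅) (r : ℝ) (a : 𝔄) :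
    φ (r • a) = r • φ a := by
  rw [← Complex.coe_smul, map_smul, Complex.coe_smul]

lemma PositiveLinearMap.map_algebraMap_real (φ : 𝔄 →ₚ[ℂ] 𝔅) (r : ℝ) :
    φ (algebraMap ℝ 𝔄 r) = r • φ 1 := by
  rw [Algebra.algebraMap_eq_smul_one, φ.map_real_smul]

/-- Apply φ to -‖a‖ ≤ a ≤ ‖a‖. The constant depends on φ only through φ(1), so it varies
continuously along a field. -/
lemma PositiveLinearMap.norm_apply_le_of_isSelfAdjoint (φ : 𝔄 →ₚ[ℂ] 𝔅) {a : 𝔄}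
    (ha : IsSelfAdjoint a) : ‖φ a‖ ≤ ‖a‖ * ‖φ 1‖ := by
  have h1 : 0 ≤ φ 1 := φ.map_nonneg zero_le_one
  have h1' : φ 1 ≤ algebraMap ℝ 𝔅 ‖φ 1‖ := IsSelfAdjoint.le_algebraMap_norm_self (.of_nonneg h1)
  have key : ∀ b : 𝔄, IsSelfAdjoint b → φ b ≤ algebraMap ℝ 𝔅 (‖b‖ * ‖φ 1‖) := fun b hb =>
    calc φ b ≤ φ (algebraMap ℝ 𝔄 ‖b‖) :=
          OrderHomClass.mono φ (IsSelfAdjoint.le_algebraMap_norm_self hb)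
      _ = ‖b‖ • φ 1 := φ.map_algebraMap_real _
      _ ≤ ‖b‖ • algebraMap ℝ 𝔅 ‖φ 1‖ := smul_le_smul_of_nonneg_left h1' (norm_nonneg _)
      _ = algebraMap ℝ 𝔅 (‖b‖ * ‖φ 1‖) := by
        rw [Algebra.algebraMap_eq_smul_one, Algebra.algebraMap_eq_smul_one, smul_smul]
  refine norm_le_of_neg_algebraMap_le_of_le (ha.map φ) (by positivity) ?_ (key a ha)
  have := key (-a) ha.neg
  rw [map_neg, norm_neg] at this
  rw [map_neg]
  exact neg_le.1 this

variable {T : Type*} [TopologicalSpace T]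

/-- A strongly continuous field of positive maps applied to a continuous field of self-adjoint
elements is norm continuous. -/
lemma continuous_apply_field {Φ : T → 𝔄 →ₚ[ℂ] 𝔅} (hΦ : ∀ a, Continuous fun t => Φ t a)
    {X : T → 𝔄} (hX : Continuous X) (hXs : ∀ t, IsSelfAdjoint (X t)) :
    Continuous fun t => Φ t (X t) := by
  rw [continuous_iff_continuousAt]
  intro t₀
  have h1 : Filter.Tendsto (fun t => ‖X t - X t₀‖ * ‖Φ t 1‖) (nhds t₀) (nhds 0) := by
    have : Continuous fun t => ‖X t - X t₀‖ * ‖Φ t 1‖ :=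
      (hX.sub continuous_const).norm.mul (hΦ 1).norm
    simpa using this.tendsto t₀
  have h2 : Filter.Tendsto (fun t => Φ t (X t - X t₀)) (nhds t₀) (nhds 0) :=
    squeeze_zero_norm
      (fun t => (Φ t).norm_apply_le_of_isSelfAdjoint ((hXs t).sub (hXs t₀))) h1
  have h3 := h2.add ((hΦ (X t₀)).tendsto t₀)
  simp only [map_sub, sub_add_cancel, zero_add] at h3
  exact h3

lemma IsStrictlyPositiveField.cfc {f : ℝ → ℝ} (hf : ContinuousOn f (Set.Ioi 0)) {A : T → 𝔄}
    (hA : IsStrictlyPositiveField A) : Continuous fun t => cfc f (A t) :=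
  (continuousOn_cfc_isStrictlyPositive hf).comp_continuous hA.continuous hA.isStrictlyPositive

lemma IsStrictlyPositiveField.continuous_rpow {A : T → 𝔄} (hA : IsStrictlyPositiveField A)
    (x : ℝ) : Continuous fun t => A t ^ x := by
  simp only [rpow_eq_cfc (hA.isStrictlyPositive _).nonneg x]
  exact hA.cfc fun y hy => (Real.continuousAt_rpow_const y x (.inl hy.ne')).continuousWithinAt

lemma IsStrictlyPositiveField.rpow_conjugate {A B : T → 𝔄} (hA : IsStrictlyPositiveField A)
    (hB : IsStrictlyPositiveField B) (x : ℝ) :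
    IsStrictlyPositiveField fun t => B t ^ x * A t * B t ^ x where
  continuous := ((hB.continuous_rpow x).mul hA.continuous).mul (hB.continuous_rpow x)
  isStrictlyPositive t :=
    isStrictlyPositive_rpow_conjugate (hA.isStrictlyPositive t) (hB.isStrictlyPositive t) x

/-- A lower bound r at one point survives as r/2 nearby; compactness makes it uniform. -/
lemma IsStrictlyPositiveField.exists_pos_algebraMap_le {A : T → 𝔄}
    (hA : IsStrictlyPositiveField A) {K : Set T} (hK : IsCompact K) :
    ∃ r : ℝ, 0 < r ∧ ∀ t ∈ K, algebraMap ℝ 𝔄 r ≤ A t := by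
  refine hK.induction_on (p := fun s => ∃ r : ℝ, 0 < r ∧ ∀ t ∈ s, algebraMap ℝ 𝔄 r ≤ A t)
    ⟨1, one_pos, by simp⟩ (fun s t hst ⟨r, hr, h⟩ => ⟨r, hr, fun x hx => h x (hst hx)⟩) ?_ ?_
  · rintro s t ⟨r₁, hr₁, h₁⟩ ⟨r₂, hr₂, h₂⟩
    refine ⟨min r₁ r₂, lt_min hr₁ hr₂, fun x hx => ?_⟩
    rcases hx with hx | hx
    · exact (algebraMap_mono 𝔄 (min_le_left _ _)).trans (h₁ x hx)
    · exact (algebraMap_mono 𝔄 (min_le_right _ _)).trans (h₂ x hx)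
  · intro t₀ _
    obtain ⟨r, hr, h⟩ := (hA.isStrictlyPositive t₀).exists_pos_algebraMap_le
    have hnear : ∀ᶠ t in nhds t₀, ‖A t₀ - A t‖ < r / 2 := by
      have : Continuous fun t => ‖A t₀ - A t‖ := (continuous_const.sub hA.continuous).norm
      refine this.continuousAt.eventually_lt continuousAt_const ?_
      simpa using half_pos hr
    refine ⟨_, nhdsWithin_le_nhds hnear, r / 2, half_pos hr, fun t ht => ?_⟩
    have h1 : A t₀ - A t ≤ algebraMap ℝ 𝔄 (r / 2) :=
      (IsSelfAdjoint.le_algebraMap_norm_self ((hA.isStrictlyPositive t₀).isSelfAdjoint.sub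
        (hA.isStrictlyPositive t).isSelfAdjoint)).trans (algebraMap_mono 𝔄 (le_of_lt ht))
    have h2 : algebraMap ℝ 𝔄 r = algebraMap ℝ 𝔄 (r / 2) + algebraMap ℝ 𝔄 (r / 2) := by
      rw [← map_add, add_halves]
    rw [h2] at h
    have h3 := h.trans (sub_le_iff_le_add.1 h1)
    exact le_of_add_le_add_left h3

end PositiveMaps

/-! ### Exhaustion by compact sets and strict positivity of averages -/

section Measure

variable {T : Type*} [TopologicalSpace T] [T2Space T] [MeasurableSpace T] [BorelSpace T]
  (μ : Measure T) [IsFiniteMeasure μ] [μ.Regular]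

lemma exists_seq_isCompact_tendsto_measure_compl :
    ∃ K : ℕ → Set T, (∀ n, IsCompact (K n)) ∧
      Filter.Tendsto (fun n => μ (K n)ᶜ) Filter.atTop (nhds 0) := by
  have h : ∀ n : ℕ, ∃ K : Set T, IsCompact K ∧ μ Kᶜ ≤ ((n : ENNReal) + 1)⁻¹ := fun n => by
    obtain ⟨K, -, hK, hμ⟩ := MeasurableSet.univ.exists_isCompact_sdiff_lt (measure_ne_top μ _)
      (ε := ((n : ENNReal) + 1)⁻¹) (by simp)
    rw [← Set.compl_eq_univ_sdiff] at hμ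
    exact ⟨K, hK, hμ.le⟩
  choose K hK hμ using h
  refine ⟨K, hK, tendsto_of_tendsto_of_tendsto_of_le_of_le tendsto_const_nhds ?_
    (fun _ => zero_le) hμ⟩
  have := ENNReal.tendsto_inv_nat_nhds_zero.comp (Filter.tendsto_add_atTop_nat 1)
  simpa [Function.comp_def] using this

variable {μ} in
lemma tendsto_setIntegral_of_tendsto_measure_compl {E : Type*} [NormedAddCommGroup E]
    [NormedSpace ℝ E] {F : T → E} (hF : Integrable F μ) {K : ℕ → Set T}
    (hK : ∀ n, IsCompact (K n)) (hμ : Filter.Tendsto (fun n => μ (K n)ᶜ) Filter.atTop (nhds 0)) :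
    Filter.Tendsto (fun n => ∫ t in K n, F t ∂μ) Filter.atTop (nhds (∫ t, F t ∂μ)) := by
  have h := (tendsto_const_nhds (x := ∫ t, F t ∂μ)).sub (hF.tendsto_setIntegral_nhds_zero hμ)
  rw [sub_zero] at h
  refine h.congr fun n => ?_
  rw [← integral_add_compl (hK n).measurableSet hF, add_sub_cancel_right]

variable {μ} in
-- Neither T nor E need be separable: almost all of T lies in countably many compact sets, on each
-- of which a continuous map is strongly measurable.
lemma Continuous.aestronglyMeasurable_of_regular {E : Type*} [NormedAddCommGroup E] {F : T → E}
    (hF : Continuous F) : AEStronglyMeasurable F μ := by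
  obtain ⟨K, hK, hμ⟩ := exists_seq_isCompact_tendsto_measure_compl μ
  have h : ∀ᵐ t ∂μ, t ∈ ⋃ n, K n := by
    change (⋃ n, K n) ∈ ae μ
    rw [mem_ae_iff, ← nonpos_iff_eq_zero]
    refine ge_of_tendsto' hμ fun n => measure_mono ?_
    exact Set.compl_subset_compl.2 (Set.subset_iUnion K n)
  rw [← Measure.restrict_eq_self_of_ae_mem h, aestronglyMeasurable_iUnion_iff]
  exact fun n => hF.continuousOn.aestronglyMeasurable_of_isCompact (hK n) (hK n).measurableSet

variable {𝔄 𝔅 : Type*} [CStarAlgebra 𝔄] [PartialOrder 𝔄] [StarOrderedRing 𝔄]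
  [CStarAlgebra 𝔅] [PartialOrder 𝔅] [StarOrderedRing 𝔅]

variable {μ} in
lemma integrable_of_nonneg_of_le {F G : T → 𝔅} (hF : Continuous F) (h0 : ∀ t, 0 ≤ F t)
    (hFG : ∀ t, F t ≤ G t) (hG : Integrable G μ) : Integrable F μ :=
  hG.mono hF.aestronglyMeasurable_of_regular
    (ae_of_all _ fun t => CStarAlgebra.norm_le_norm_of_nonneg_of_le (h0 t) (hFG t))

variable {μ} in
/-- A unital field of positive maps averages strictly positive fields to strictly positive
elements. -/
lemma IsUnitalField.isStrictlyPositive_integral {Φ : T → 𝔄 →ₚ[ℂ] 𝔅} (hΦ : IsUnitalField μ Φ)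
    {A : T → 𝔄} (hA : IsStrictlyPositiveField A) (hint : Integrable (fun t => Φ t (A t)) μ) :
    IsStrictlyPositive (∫ t, Φ t (A t) ∂μ) := by
  obtain ⟨K, hK, hμ⟩ := exists_seq_isCompact_tendsto_measure_compl μ
  have hlim := tendsto_setIntegral_of_tendsto_measure_compl hΦ.integrable_one hK hμ
  rw [hΦ.integral_one] at hlim
  -- `A` may have no uniform lower bound on all of T. As units form an open set, ∫_K Φ_t(1) is
  -- already invertible for some compact K, where such a bound exists.
  have hopen : ∀ᶠ b in nhds (1 : 𝔅), IsUnit b := Units.isOpen.mem_nhds isUnit_one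
  obtain ⟨n, hn⟩ := (hlim.eventually hopen).exists
  obtain ⟨r, hr, hrA⟩ := hA.exists_pos_algebraMap_le (hK n)
  have h1 : IsStrictlyPositive (r • ∫ t in K n, Φ t 1 ∂μ) :=
    .smul hr (hn.isStrictlyPositive (integral_nonneg fun t => (Φ t).map_nonneg zero_le_one))
  refine h1.of_le ?_
  calc r • ∫ t in K n, Φ t 1 ∂μ = ∫ t in K n, r • Φ t 1 ∂μ := (integral_smul _ _).symm
    _ ≤ ∫ t in K n, Φ t (A t) ∂μ := by
      refine setIntegral_mono_on (hΦ.integrable_one.smul r).integrableOn hint.integrableOn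
        (hK n).measurableSet fun t ht => ?_
      rw [← (Φ t).map_algebraMap_real]
      exact OrderHomClass.mono (Φ t) (hrA t ht)
    _ ≤ ∫ t, Φ t (A t) ∂μ := setIntegral_le_integral hint
      (ae_of_all _ fun t => (Φ t).map_nonneg (hA.isStrictlyPositive t).nonneg)

end Measure

/-! ### Scalar approximation by partitions of unity -/

section Partition

/-- A continuous function on a compact interval of positive numbers is, together with the identity,
uniformly approximated by means over a finite partition of unity. -/
lemma exists_partition_approx {f : ℝ → ℝ} {a b : ℝ} (ha : 0 < a)
    (hf : ContinuousOn f (Set.Icc a b)) {ε : ℝ} (hε : 0 < ε) :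
    ∃ (ι : Type) (_ : Fintype ι) (x : ι → ℝ) (h : ι → ℝ → ℝ),
      (∀ i, 0 < x i) ∧ (∀ i, Continuous (h i)) ∧ (∀ i y, 0 ≤ h i y) ∧
      (∀ y ∈ Set.Icc a b, ∑ i, h i y = 1) ∧
      (∀ y ∈ Set.Icc a b, |∑ i, x i * h i y - y| ≤ ε) ∧
      (∀ y ∈ Set.Icc a b, |∑ i, f (x i) * h i y - f y| ≤ ε) := by
  obtain ⟨δ, hδ, hfδ⟩ := Metric.uniformContinuousOn_iff.1
    (isCompact_Icc.uniformContinuousOn_of_continuous hf) ε hε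
  -- δ controls the oscillation of f, and ε that of the identity.
  set η := min δ ε
  have hη : 0 < η := lt_min hδ hε
  obtain ⟨s, hs, hfin, hcover⟩ := (isCompact_Icc (a := a) (b := b)).finite_cover_balls hη
  obtain ⟨ρ, hρ⟩ := PartitionOfUnity.exists_isSubordinate (isClosed_Icc (a := a) (b := b))
    (fun i : s => Metric.ball (i : ℝ) η) (fun _ => Metric.isOpen_ball)
    (by simpa [Set.iUnion_subtype] using hcover)
  have := hfin.fintype
  have hsum : ∀ y ∈ Set.Icc a b, ∑ i, ρ i y = 1 := fun y hy => by
    rw [← finsum_eq_sum_of_fintype]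
    exact ρ.sum_eq_one hy
  have hmean : ∀ y ∈ Set.Icc a b, ∀ (c : s → ℝ) (d : ℝ),
      (∀ i : s, dist (i : ℝ) y < η → |c i - d| ≤ ε) → |∑ i, c i * ρ i y - d| ≤ ε := by
    intro y hy c d hcd
    have e : ∑ i, c i * ρ i y - d = ∑ i, (c i - d) * ρ i y := by
      simp only [sub_mul, Finset.sum_sub_distrib, ← Finset.mul_sum, hsum y hy, mul_one]
    rw [e]
    calc |∑ i, (c i - d) * ρ i y| ≤ ∑ i, |(c i - d) * ρ i y| := Finset.abs_sum_le_sum_abs _ _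
      _ ≤ ∑ i, ε * ρ i y := by
        refine Finset.sum_le_sum fun i _ => ?_
        rw [abs_mul, abs_of_nonneg (ρ.nonneg i y)]
        rcases eq_or_ne (ρ i y) 0 with h0 | h0
        · simp [h0]
        · have hy' : y ∈ Metric.ball (i : ℝ) η := hρ i (subset_tsupport _ h0)
          exact mul_le_mul_of_nonneg_right (hcd i (Metric.mem_ball'.1 hy')) (ρ.nonneg i y)
      _ = ε := by rw [← Finset.mul_sum, hsum y hy, mul_one]
  refine ⟨s, inferInstance, fun i => i, fun i => ρ i, fun i => ha.trans_le (hs i.2).1,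
    fun i => (ρ i).continuous, fun i y => ρ.nonneg i y, hsum, fun y hy => hmean y hy _ _ ?_,
    fun y hy => hmean y hy (fun i => f i) _ ?_⟩
  · exact fun i hi => (hi.le.trans (min_le_right _ _))
  · exact fun i hi => (hfδ i (hs i.2) y hy (hi.trans_le (min_le_left _ _))).le

end Partition

/-! ### Jensen's inequality for unital fields -/

section Jensen

variable {𝔄 𝔅 : Type*} [CStarAlgebra 𝔄] [PartialOrder 𝔄] [StarOrderedRing 𝔄]
  [CStarAlgebra 𝔅] [PartialOrder 𝔅] [StarOrderedRing 𝔅]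

/-- The order is closed, and the calculus of f is continuous on strictly positive elements, which is
why the approximants `U` must be strictly positive. -/
lemma cfc_le_of_forall_exists_near {f : ℝ → ℝ} (hf : ContinuousOn f (Set.Ioi 0)) {S R : 𝔅}
    (hS : IsStrictlyPositive S) (M : ℝ)
    (h : ∀ ε : ℝ, 0 < ε → ∃ U V : 𝔅, IsStrictlyPositive U ∧ cfc f U ≤ V ∧
      ‖U - S‖ ≤ M * ε ∧ ‖V - R‖ ≤ M * ε) : cfc f S ≤ R := by
  have hpos : ∀ n : ℕ, (0 : ℝ) < 1 / ((n : ℝ) + 1) := fun n => by positivity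
  choose U V hU hUV hUS hVR using fun n : ℕ => h _ (hpos n)
  have hM : Filter.Tendsto (fun n : ℕ => M * (1 / ((n : ℝ) + 1))) Filter.atTop (nhds 0) := by
    simpa using (tendsto_one_div_add_atTop_nhds_zero_nat (𝕜 := ℝ)).const_mul M
  have hUlim : Filter.Tendsto U Filter.atTop (nhds S) :=
    tendsto_iff_norm_sub_tendsto_zero.2 (squeeze_zero (fun _ => norm_nonneg _) hUS hM)
  have hVlim : Filter.Tendsto V Filter.atTop (nhds R) :=
    tendsto_iff_norm_sub_tendsto_zero.2 (squeeze_zero (fun _ => norm_nonneg _) hVR hM)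
  have hcfc : Filter.Tendsto (fun n => cfc f (U n)) Filter.atTop (nhds (cfc f S)) :=
    ((continuousOn_cfc_isStrictlyPositive hf) S hS).tendsto.comp
      (tendsto_nhdsWithin_iff.2 ⟨hUlim, Filter.Eventually.of_forall hU⟩)
  exact le_of_tendsto_of_tendsto' hcfc hVlim hUV

variable {T : Type*} [TopologicalSpace T] [T2Space T] [MeasurableSpace T] [BorelSpace T]
  {μ : Measure T} [IsFiniteMeasure μ]

lemma IsUnitalField.continuous_apply_cfc {Φ : T → 𝔄 →ₚ[ℂ] 𝔅} (hΦ : IsUnitalField μ Φ)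
    {A : T → 𝔄} (hA : IsStrictlyPositiveField A) {g : ℝ → ℝ} (hg : ContinuousOn g (Set.Ioi 0)) :
    Continuous fun t => Φ t (cfc g (A t)) :=
  continuous_apply_field hΦ.continuous (hA.cfc hg) fun _ => cfc_predicate g _

lemma IsUnitalField.integrableOn_apply_cfc {Φ : T → 𝔄 →ₚ[ℂ] 𝔅} (hΦ : IsUnitalField μ Φ)
    {A : T → 𝔄} (hA : IsStrictlyPositiveField A) {g : ℝ → ℝ} (hg : ContinuousOn g (Set.Ioi 0))
    {K : Set T} (hK : IsCompact K) : IntegrableOn (fun t => Φ t (cfc g (A t))) K μ :=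
  (hΦ.continuous_apply_cfc hA hg).continuousOn.integrableOn_compact hK

/-- The constant is an integral over all of T, so the bound does not depend on `K`, which is chosen
after ε. -/
lemma IsUnitalField.norm_setIntegral_sub_le {Φ : T → 𝔄 →ₚ[ℂ] 𝔅} (hΦ : IsUnitalField μ Φ)
    {A : T → 𝔄} (hA : IsStrictlyPositiveField A) {g₁ g₂ : ℝ → ℝ}
    (hg₁ : ContinuousOn g₁ (Set.Ioi 0)) (hg₂ : ContinuousOn g₂ (Set.Ioi 0))
    {K : Set T} (hK : IsCompact K) {ε : ℝ} (hε : 0 ≤ ε)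
    (h : ∀ t ∈ K, ∀ y ∈ spectrum ℝ (A t), |g₁ y - g₂ y| ≤ ε) :
    ‖∫ t in K, Φ t (cfc g₁ (A t)) ∂μ - ∫ t in K, Φ t (cfc g₂ (A t)) ∂μ‖ ≤
      (∫ t, ‖Φ t 1‖ ∂μ) * ε := by
  rw [← integral_sub (hΦ.integrableOn_apply_cfc hA hg₁ hK) (hΦ.integrableOn_apply_cfc hA hg₂ hK)]
  have hint : Integrable (fun t => ε * ‖Φ t 1‖) μ := hΦ.integrable_one.norm.const_mul ε
  calc _ ≤ ∫ t in K, ε * ‖Φ t 1‖ ∂μ := by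
        refine norm_integral_le_of_norm_le hint.integrableOn
          ((ae_restrict_iff' hK.measurableSet).2 (ae_of_all _ fun t ht => ?_))
        have hs : spectrum ℝ (A t) ⊆ Set.Ioi 0 := fun x hx =>
          (hA.isStrictlyPositive t).spectrum_pos hx
        rw [← map_sub, ← cfc_sub g₁ g₂ (A t) (hg₁.mono hs) (hg₂.mono hs)]
        refine ((Φ t).norm_apply_le_of_isSelfAdjoint (cfc_predicate _ _)).trans ?_
        exact mul_le_mul_of_nonneg_right (norm_cfc_le hε fun y hy => h t ht y hy) (norm_nonneg _)
    _ ≤ ∫ t, ε * ‖Φ t 1‖ ∂μ := setIntegral_le_integral hint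
        (ae_of_all _ fun t => mul_nonneg hε (norm_nonneg _))
    _ = (∫ t, ‖Φ t 1‖ ∂μ) * ε := by rw [integral_const_mul, mul_comm]

lemma IsUnitalField.sum_smul_setIntegral {Φ : T → 𝔄 →ₚ[ℂ] 𝔅} (hΦ : IsUnitalField μ Φ)
    {A : T → 𝔄} (hA : IsStrictlyPositiveField A) {ι : Type*} [Fintype ι] (c : ι → ℝ)
    {h : ι → ℝ → ℝ} (hh : ∀ i, Continuous (h i)) {K : Set T} (hK : IsCompact K) :
    ∑ i, c i • ∫ t in K, Φ t (cfc (h i) (A t)) ∂μ =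
      ∫ t in K, Φ t (cfc (fun y => ∑ i, c i * h i y) (A t)) ∂μ := by
  have e : ∀ t, Φ t (cfc (fun y => ∑ i, c i * h i y) (A t)) =
      ∑ i, c i • Φ t (cfc (h i) (A t)) := fun t => by
    have : (fun y => ∑ i, c i * h i y) = ∑ i, fun y => c i • h i y := by
      ext y
      simp
    rw [this, cfc_sum (fun i y => c i • h i y) _ _
      (fun i _ => ((hh i).const_smul (c i)).continuousOn), map_sum]
    refine Finset.sum_congr rfl fun i _ => ?_
    rw [cfc_smul (c i) (h i) (A t) (hh i).continuousOn, (Φ t).map_real_smul]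
  simp only [e]
  rw [integral_finsetSum (f := fun i t => c i • Φ t (cfc (h i) (A t))) _ fun i _ =>
    (hΦ.integrableOn_apply_cfc hA (hh i).continuousOn hK).smul (c i)]
  exact Finset.sum_congr rfl fun i _ => (integral_smul _ _).symm

end Jensen

/-- Jensen's inequality for unital fields of positive linear maps. -/
lemma OperatorLogConvex.cfc_integral_le {f : ℝ → ℝ} (hf : ContinuousOn f (Set.Ioi 0))
    (hpos : ∀ x : ℝ, 0 < x → 0 < f x) (h : OperatorLogConvex.{u} f)
    {T : Type*} [TopologicalSpace T] [T2Space T] [MeasurableSpace T] [BorelSpace T]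
    {μ : Measure T} [IsFiniteMeasure μ] [μ.Regular]
    {𝔄 : Type*} {𝔅 : Type u} [CStarAlgebra 𝔄] [PartialOrder 𝔄] [StarOrderedRing 𝔄]
    [CStarAlgebra 𝔅] [PartialOrder 𝔅] [StarOrderedRing 𝔅]
    {Φ : T → 𝔄 →ₚ[ℂ] 𝔅} (hΦ : IsUnitalField μ Φ) {A : T → 𝔄} (hA : IsStrictlyPositiveField A)
    (hint : Integrable (fun t => Φ t (A t)) μ)
    (hintf : Integrable (fun t => Φ t (cfc f (A t))) μ) :
    cfc f (∫ t, Φ t (A t) ∂μ) ≤ ∫ t, Φ t (cfc f (A t)) ∂μ := by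
  set C := ∫ t, ‖Φ t 1‖ ∂μ
  have hC : 0 ≤ C := integral_nonneg fun _ => norm_nonneg _
  have hf1 := (hpos 1 one_pos).le
  refine cfc_le_of_forall_exists_near hf (hΦ.isStrictlyPositive_integral hA hint)
    -- This dominates both C + 2, the factor in the error for the argument, and C + 1 + f(1), the
    -- factor for the values.
    (C + 1 + (1 + f 1)) fun ε hε => ?_
  obtain ⟨K', hK', hμ⟩ := exists_seq_isCompact_tendsto_measure_compl μ
  have near : ∀ {F : T → 𝔅}, Integrable F μ →
      ∀ᶠ n in Filter.atTop, ‖∫ t in K' n, F t ∂μ - ∫ t, F t ∂μ‖ < ε := fun hF => by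
    have := tendsto_setIntegral_of_tendsto_measure_compl hF hK' hμ
    exact (tendsto_iff_norm_sub_tendsto_zero.1 this).eventually_lt_const hε
  obtain ⟨n, ⟨h1, hS⟩, hR⟩ := ((near hΦ.integrable_one).and (near hint)).and (near hintf) |>.exists
  have hK := hK' n
  generalize K' n = K at *
  obtain ⟨r, hr, hrA⟩ := hA.exists_pos_algebraMap_le hK
  obtain ⟨b, hb⟩ := hK.exists_bound_of_continuousOn hA.continuous.continuousOn
  have hspec : ∀ t ∈ K, spectrum ℝ (A t) ⊆ Set.Icc r b := fun t ht =>
    spectrum_subset_Icc (hA.isStrictlyPositive t).isSelfAdjoint (hrA t ht)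
      ((IsSelfAdjoint.le_algebraMap_norm_self (hA.isStrictlyPositive t).isSelfAdjoint).trans
        (algebraMap_mono 𝔄 (hb t ht)))
  obtain ⟨ι, _, x, w, hx, hw, hw0, hw1, hwx, hwf⟩ := exists_partition_approx (b := b) hr
    (hf.mono fun y hy => hr.trans_le hy.1) hε
  have hsumc : ∀ c : ι → ℝ, ContinuousOn (fun y => ∑ i, c i * w i y) (Set.Ioi 0) := fun c =>
    (continuous_finsetSum _ fun i _ => continuous_const.mul (hw i)).continuousOn
  set P : ι → 𝔅 := fun i => ∫ t in K, Φ t (cfc (w i) (A t)) ∂μ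
  -- The mass outside K restores total mass 1. It is placed at the node 1 and costs at most ε in the
  -- argument and f(1)ε in the values.
  set P₀ : 𝔅 := 1 - ∫ t in K, Φ t 1 ∂μ
  have hP : ∀ i, 0 ≤ P i := fun i =>
    integral_nonneg fun t => (Φ t).map_nonneg (cfc_nonneg fun y _ => hw0 i y)
  have hP₀ : 0 ≤ P₀ := by
    rw [sub_nonneg, ← hΦ.integral_one]
    exact setIntegral_le_integral hΦ.integrable_one
      (ae_of_all _ fun t => (Φ t).map_nonneg zero_le_one)
  have hP₀ε : ‖P₀‖ ≤ ε := by
    rw [norm_sub_rev, ← hΦ.integral_one]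
    exact h1.le
  have hsumP : ∑ i, P i = ∫ t in K, Φ t 1 ∂μ := by
    have e := hΦ.sum_smul_setIntegral hA (fun _ => 1) hw hK
    simp only [one_smul, one_mul] at e
    rw [e]
    refine setIntegral_congr_fun hK.measurableSet fun t ht => ?_
    have : cfc (fun y => ∑ i, w i y) (A t) = 1 := by
      rw [cfc_congr (g := fun _ => (1 : ℝ)) fun y hy => hw1 y (hspec t ht hy)]
      exact cfc_const_one ℝ (A t) (hA.isStrictlyPositive t).isSelfAdjoint
    simp only [this]
  let Q : Option ι → 𝔅 := fun o => o.elim P₀ P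
  let z : Option ι → ℝ := fun o => o.elim 1 x
  have hQ : ∀ o, 0 ≤ Q o := fun o => by cases o <;> simp [Q, hP₀, hP]
  have hQ1 : ∑ o, Q o = 1 := by
    rw [Fintype.sum_option]
    simp only [Q, Option.elim, hsumP, P₀, sub_add_cancel]
  have hz : ∀ o, 0 < z o := fun o => by cases o <;> simp [z, hx]
  refine ⟨∑ o, z o • Q o, ∑ o, f (z o) • Q o, isStrictlyPositive_sum_smul hQ hQ1 hz,
    h.cfc_sum_smul_le hf hpos hQ hQ1 hz, ?_, ?_⟩
  · have e := hΦ.norm_setIntegral_sub_le hA (hsumc x) continuousOn_id hK hε.le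
      fun t ht y hy => hwx y (hspec t ht hy)
    simp only [cfc_id ℝ _ (hA.isStrictlyPositive _).isSelfAdjoint] at e
    rw [← hΦ.sum_smul_setIntegral hA x hw hK] at e
    rw [Fintype.sum_option]
    simp only [Q, z, Option.elim, one_smul]
    calc _ = ‖P₀ + ((∑ i, x i • P i - ∫ t in K, Φ t (A t) ∂μ) +
          (∫ t in K, Φ t (A t) ∂μ - ∫ t, Φ t (A t) ∂μ))‖ := by congr 1; abel
      _ ≤ ε + (C * ε + ε) := norm_add_le_of_le hP₀ε (norm_add_le_of_le e hS.le)
      _ ≤ (C + 1 + (1 + f 1)) * ε := by nlinarith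
  · have e := hΦ.norm_setIntegral_sub_le hA (hsumc fun i => f (x i)) hf hK hε.le
      fun t ht y hy => hwf y (hspec t ht hy)
    rw [← hΦ.sum_smul_setIntegral hA (fun i => f (x i)) hw hK] at e
    rw [Fintype.sum_option]
    simp only [Q, z, Option.elim]
    calc _ = ‖f 1 • P₀ + ((∑ i, f (x i) • P i - ∫ t in K, Φ t (cfc f (A t)) ∂μ) +
          (∫ t in K, Φ t (cfc f (A t)) ∂μ - ∫ t, Φ t (cfc f (A t)) ∂μ))‖ := by congr 1; abel
      _ ≤ f 1 * ε + (C * ε + ε) := by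
        refine norm_add_le_of_le ?_ (norm_add_le_of_le e hR.le)
        rw [norm_smul, Real.norm_of_nonneg hf1]
        exact mul_le_mul_of_nonneg_left hP₀ε hf1
      _ ≤ (C + 1 + (1 + f 1)) * ε := by nlinarith

/-! ### Renormalised fields and the perspective inequality -/

section Conjugation

variable {𝔄 𝔅 : Type*} [CStarAlgebra 𝔄] [PartialOrder 𝔄] [StarOrderedRing 𝔄]
  [CStarAlgebra 𝔅] [PartialOrder 𝔅] [StarOrderedRing 𝔅]

/-- The positive map `a ↦ N φ(b a b) N` for self-adjoint `b` and `N`. -/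
noncomputable def PositiveLinearMap.conjugate (φ : 𝔄 →ₚ[ℂ] 𝔅) {b : 𝔄} {N : 𝔅}
    (hb : IsSelfAdjoint b) (hN : IsSelfAdjoint N) : 𝔄 →ₚ[ℂ] 𝔅 :=
  .mk₀ (LinearMap.mulLeft ℂ N ∘ₗ LinearMap.mulRight ℂ N ∘ₗ φ.toLinearMap ∘ₗ
      LinearMap.mulLeft ℂ b ∘ₗ LinearMap.mulRight ℂ b) fun a ha => by
    have h := hN.conjugate_nonneg (φ.map_nonneg (hb.conjugate_nonneg ha))
    rw [mul_assoc N, mul_assoc b] at h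
    exact h

lemma PositiveLinearMap.conjugate_apply (φ : 𝔄 →ₚ[ℂ] 𝔅) {b : 𝔄} {N : 𝔅}
    (hb : IsSelfAdjoint b) (hN : IsSelfAdjoint N) (a : 𝔄) :
    φ.conjugate hb hN a = N * φ (b * a * b) * N := by
  rw [mul_assoc N, mul_assoc b]
  rfl

/-- Continuity along fields is available for self-adjoint elements, hence the split into real and
imaginary parts. -/
lemma continuous_apply_conjugate {T : Type*} [TopologicalSpace T] {Φ : T → 𝔄 →ₚ[ℂ] 𝔅}
    (hΦ : ∀ a, Continuous fun t => Φ t a) {b : T → 𝔄} (hb : Continuous b)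
    (hbs : ∀ t, IsSelfAdjoint (b t)) (a : 𝔄) : Continuous fun t => Φ t (b t * a * b t) := by
  have h : ∀ x : selfAdjoint 𝔄, Continuous fun t => Φ t (b t * x * b t) := fun x =>
    continuous_apply_field hΦ ((hb.mul continuous_const).mul hb) fun t => by
      have := x.2.conjugate (b t)
      rwa [(hbs t).star_eq] at this
  have e : ∀ t, Φ t (b t * a * b t) = Φ t (b t * (realPart a : 𝔄) * b t) +
      Complex.I • Φ t (b t * (imaginaryPart a : 𝔄) * b t) := fun t => by
    conv_lhs => rw [← realPart_add_I_smul_imaginaryPart a]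
    rw [mul_add, add_mul, map_add, mul_smul_comm, smul_mul_assoc, map_smul]
  simp only [e]
  exact (h _).add ((h _).const_smul _)

lemma integral_mul_mul {T R : Type*} [MeasurableSpace T] {μ : Measure T} [NormedRing R]
    [NormedAlgebra ℝ R] [CompleteSpace R] {F : T → R} (hF : Integrable F μ) (N : R) : ∫ t, N * F t * N ∂μ = N * (∫ t, F t ∂μ) * N := by
  rw [integral_mul_const_of_integrable (hF.const_mul N), integral_const_mul_of_integrable hF]

end Conjugation

section Perspective

variable {T : Type*} [TopologicalSpace T] [T2Space T] [MeasurableSpace T] [BorelSpace T]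
  {μ : Measure T} [IsFiniteMeasure μ] [μ.Regular]
  {𝔄 𝔅 : Type*} [CStarAlgebra 𝔄] [PartialOrder 𝔄] [StarOrderedRing 𝔄]
  [CStarAlgebra 𝔅] [PartialOrder 𝔅] [StarOrderedRing 𝔅]

/-- Renormalising a field of positive maps by `B` and `M = ∫ Φ_t(B_t)` gives a unital field. -/
lemma IsUnitalField.conjugate {Φ : T → 𝔄 →ₚ[ℂ] 𝔅} (hΦ : IsUnitalField μ Φ) {B : T → 𝔄}
    (hB : IsStrictlyPositiveField B) (hint : Integrable (fun t => Φ t (B t)) μ) :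
    IsUnitalField μ fun t => (Φ t).conjugate (isSelfAdjoint_rpow (B t) (1 / 2))
      (isSelfAdjoint_rpow (∫ t, Φ t (B t) ∂μ) (-(1 / 2))) := by
  have hM := hΦ.isStrictlyPositive_integral hB hint
  set M := ∫ t, Φ t (B t) ∂μ
  have e : ∀ t, (Φ t).conjugate (isSelfAdjoint_rpow (B t) (1 / 2))
      (isSelfAdjoint_rpow M (-(1 / 2))) 1 = M ^ (-(1 / 2) : ℝ) * Φ t (B t) * M ^ (-(1 / 2) : ℝ) :=
    fun t => by
      rw [PositiveLinearMap.conjugate_apply, mul_one,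
        rpow_half_mul_rpow_half (hB.isStrictlyPositive t)]
  refine ⟨fun a => ?_, ?_, ?_⟩
  · simp only [PositiveLinearMap.conjugate_apply]
    exact (continuous_const.mul (continuous_apply_conjugate hΦ.continuous
      (hB.continuous_rpow _) (fun t => isSelfAdjoint_rpow _ _) a)).mul continuous_const
  · simp only [e]
    exact (hint.const_mul _).mul_const _
  · simp only [e]
    rw [integral_mul_mul hint]
    exact CFC.conjugate_rpow_neg_one_half M hM

end Perspective

/-- Jensen's inequality for the perspective of an operator log-convex function, normalised by
`∫ Φ_t(B_t)`. -/
lemma OperatorLogConvex.cfc_conjugate_integral_le {f : ℝ → ℝ} (hf : ContinuousOn f (Set.Ioi 0))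
    (hpos : ∀ x : ℝ, 0 < x → 0 < f x) (h : OperatorLogConvex.{u} f)
    {T : Type*} [TopologicalSpace T] [T2Space T] [MeasurableSpace T] [BorelSpace T]
    {μ : Measure T} [IsFiniteMeasure μ] [μ.Regular]
    {𝔄 : Type*} {𝔅 : Type u} [CStarAlgebra 𝔄] [PartialOrder 𝔄] [StarOrderedRing 𝔄]
    [CStarAlgebra 𝔅] [PartialOrder 𝔅] [StarOrderedRing 𝔅]
    {Φ : T → 𝔄 →ₚ[ℂ] 𝔅} (hΦ : IsUnitalField μ Φ) {A B : T → 𝔄}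
    (hA : IsStrictlyPositiveField A) (hB : IsStrictlyPositiveField B)
    (hintA : Integrable (fun t => Φ t (A t)) μ) (hintB : Integrable (fun t => Φ t (B t)) μ)
    (hintf : Integrable (fun t => Φ t (perspective f (A t) (B t))) μ) {N : 𝔅}
    (hN : N = (∫ t, Φ t (B t) ∂μ) ^ (-(1 / 2) : ℝ)) :
    cfc f (N * (∫ t, Φ t (A t) ∂μ) * N) ≤
      N * (∫ t, Φ t (perspective f (A t) (B t)) ∂μ) * N := by
  subst hN
  have hX := hA.rpow_conjugate hB (-(1 / 2))
  have e : ∀ t, B t ^ (1 / 2 : ℝ) * (B t ^ (-(1 / 2) : ℝ) * A t * B t ^ (-(1 / 2) : ℝ)) *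
      B t ^ (1 / 2 : ℝ) = A t := fun t =>
    calc _ = (B t ^ (1 / 2 : ℝ) * B t ^ (-(1 / 2) : ℝ)) * A t *
          (B t ^ (-(1 / 2) : ℝ) * B t ^ (1 / 2 : ℝ)) := by simp only [mul_assoc]
      _ = A t := by
        rw [rpow_half_mul_rpow_neg_half (hB.isStrictlyPositive t),
          rpow_neg_half_mul_rpow_half (hB.isStrictlyPositive t), one_mul, mul_one]
  have key := h.cfc_integral_le hf hpos (hΦ.conjugate hB hintB) hX
  simp only [PositiveLinearMap.conjugate_apply, e] at key
  rw [integral_mul_mul hintA] at key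
  rw [← integral_mul_mul hintf]
  exact key ((hintA.const_mul _).mul_const _) ((hintf.const_mul _).mul_const _)

lemma conjugate_mul_cancel {R : Type*} [Monoid R] {S N : R} (h₁ : S * N = 1) (h₂ : N * S = 1)
    (a : R) : S * (N * a * N) * S = a :=
  calc S * (N * a * N) * S = (S * N) * a * (N * S) := by simp only [mul_assoc]
    _ = a := by rw [h₁, h₂, one_mul, mul_one]

/-- The perspective inequality for operator log-convex functions. -/
lemma OperatorLogConvex.perspective_integral_le {f : ℝ → ℝ} (hf : ContinuousOn f (Set.Ioi 0))
    (hpos : ∀ x : ℝ, 0 < x → 0 < f x) (h : OperatorLogConvex.{u} f)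
    {T : Type*} [TopologicalSpace T] [T2Space T] [MeasurableSpace T] [BorelSpace T]
    {μ : Measure T} [IsFiniteMeasure μ] [μ.Regular]
    {𝔄 : Type*} {𝔅 : Type u} [CStarAlgebra 𝔄] [PartialOrder 𝔄] [StarOrderedRing 𝔄]
    [CStarAlgebra 𝔅] [PartialOrder 𝔅] [StarOrderedRing 𝔅]
    {Φ : T → 𝔄 →ₚ[ℂ] 𝔅} (hΦ : IsUnitalField μ Φ) {A B C : T → 𝔄}
    (hA : IsStrictlyPositiveField A) (hB : IsStrictlyPositiveField B)
    (hC : IsStrictlyPositiveField C)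
    (hAC : Integrable (fun t => Φ t (arithMean (A t) (C t))) μ)
    (hintB : Integrable (fun t => Φ t (B t)) μ)
    (hfA : Integrable (fun t => Φ t (perspective f (A t) (B t))) μ)
    (hfC : Integrable (fun t => Φ t (perspective f (C t) (B t))) μ) :
    perspective f (∫ t, Φ t (arithMean (A t) (C t)) ∂μ) (∫ t, Φ t (B t) ∂μ) ≤
      geomMean (∫ t, Φ t (perspective f (A t) (B t)) ∂μ)
        (∫ t, Φ t (perspective f (C t) (B t)) ∂μ) := by
  -- Integrability is assumed only for the mean; that of each summand follows by domination, both
  -- being positive.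
  have hsum : Integrable (fun t => Φ t (A t) + Φ t (C t)) μ := by
    have := hAC.smul (2 : ℝ)
    refine this.congr (ae_of_all _ fun t => ?_)
    simp [arithMean, smul_smul]
  have hA0 : ∀ t, 0 ≤ Φ t (A t) := fun t => (Φ t).map_nonneg (hA.isStrictlyPositive t).nonneg
  have hC0 : ∀ t, 0 ≤ Φ t (C t) := fun t => (Φ t).map_nonneg (hC.isStrictlyPositive t).nonneg
  have hintA : Integrable (fun t => Φ t (A t)) μ :=
    integrable_of_nonneg_of_le (continuous_apply_field hΦ.continuous hA.continuous
      fun t => (hA.isStrictlyPositive t).isSelfAdjoint) hA0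
      (fun t => le_add_of_nonneg_right (hC0 t)) hsum
  have hintC : Integrable (fun t => Φ t (C t)) μ :=
    integrable_of_nonneg_of_le (continuous_apply_field hΦ.continuous hC.continuous
      fun t => (hC.isStrictlyPositive t).isSelfAdjoint) hC0
      (fun t => le_add_of_nonneg_left (hA0 t)) hsum
  have hmean : ∫ t, Φ t (arithMean (A t) (C t)) ∂μ =
      arithMean (∫ t, Φ t (A t) ∂μ) (∫ t, Φ t (C t) ∂μ) := by
    simp only [arithMean, PositiveLinearMap.map_real_smul, map_add]
    rw [integral_smul, integral_add hintA hintC]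
  have hM := hΦ.isStrictlyPositive_integral hB hintB
  have kA := h.cfc_conjugate_integral_le hf hpos hΦ hA hB hintA hintB hfA rfl
  have kC := h.cfc_conjugate_integral_le hf hpos hΦ hC hB hintC hintB hfC rfl
  have hXA := isStrictlyPositive_rpow_conjugate (hΦ.isStrictlyPositive_integral hA hintA) hM
    (-(1 / 2))
  have hXC := isStrictlyPositive_rpow_conjugate (hΦ.isStrictlyPositive_integral hC hintC) hM
    (-(1 / 2))
  have h1 := rpow_half_mul_rpow_neg_half hM
  have h2 := rpow_neg_half_mul_rpow_half hM
  have hS := isSelfAdjoint_rpow (∫ t, Φ t (B t) ∂μ) (1 / 2)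
  rw [hmean, perspective]
  generalize (∫ t, Φ t (B t) ∂μ) ^ (1 / 2 : ℝ) = S at *
  generalize (∫ t, Φ t (B t) ∂μ) ^ (-(1 / 2) : ℝ) = N at *
  have hfXA := isStrictlyPositive_cfc hf hpos hXA
  have hfXC := isStrictlyPositive_cfc hf hpos hXC
  -- Log-convexity at the two normalised averages, then Jensen inside each argument of ♯.
  have hle := (h.cfc_arithMean_le hf hpos hXA hXC).trans (geomMean_mono hfXA hfXC kA kC)
  have hdist : N * arithMean (∫ t, Φ t (A t) ∂μ) (∫ t, Φ t (C t) ∂μ) * N =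
      arithMean (N * (∫ t, Φ t (A t) ∂μ) * N) (N * (∫ t, Φ t (C t) ∂μ) * N) := by
    simp only [arithMean, mul_smul_comm, smul_mul_assoc, mul_add, add_mul]
  rw [hdist]
  refine (hS.conjugate_le_conjugate hle).trans_eq ?_
  rw [← geomMean_conjugate (hfXA.of_le kA) (hfXC.of_le kC) hS ⟨⟨S, N, h1, h2⟩, rfl⟩,
    conjugate_mul_cancel h1 h2, conjugate_mul_cancel h1 h2]

lemma perspective_one {𝔄 : Type*} [CStarAlgebra 𝔄] [PartialOrder 𝔄] [StarOrderedRing 𝔄]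
    (f : ℝ → ℝ) (A : 𝔄) : perspective f A 1 = cfc f A := by
  simp [perspective]

theorem theorem3p5 (f : ℝ → ℝ) (hf : ContinuousOn f (Set.Ioi 0))
    (hpos : ∀ x : ℝ, 0 < x → 0 < f x) :
    OperatorLogConvex.{u} f ↔
      ∀ (T : Type v) [TopologicalSpace T] [LocallyCompactSpace T] [T2Space T]
        [MeasurableSpace T] [BorelSpace T] (μ : Measure T) [IsFiniteMeasure μ] [μ.Regular]
        (𝔄 𝔅 : Type u) [CStarAlgebra 𝔄] [PartialOrder 𝔄] [StarOrderedRing 𝔄]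
        [CStarAlgebra 𝔅] [PartialOrder 𝔅] [StarOrderedRing 𝔅]
        (Φ : T → 𝔄 →ₚ[ℂ] 𝔅) (A B C : T → 𝔄),
        IsUnitalField μ Φ →
        IsStrictlyPositiveField A → IsStrictlyPositiveField B → IsStrictlyPositiveField C →
        Integrable (fun t => Φ t (arithMean (A t) (C t))) μ →
        Integrable (fun t => Φ t (B t)) μ →
        Integrable (fun t => Φ t (perspective f (A t) (B t))) μ →
        Integrable (fun t => Φ t (perspective f (C t) (B t))) μ →
        perspective f (∫ t, Φ t (arithMean (A t) (C t)) ∂μ) (∫ t, Φ t (B t) ∂μ) ≤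
          geomMean (∫ t, Φ t (perspective f (A t) (B t)) ∂μ)
            (∫ t, Φ t (perspective f (C t) (B t)) ∂μ) := by
  constructor
  · intro h T _ _ _ _ _ μ _ _ 𝔄 𝔅 _ _ _ _ _ _ Φ A B C hΦ hA hB hC hAC hintB hfA hfC
    exact h.perspective_integral_le hf hpos hΦ hA hB hC hAC hintB hfA hfC
  · intro h H _ _ _ A B hA hB
    -- With a Dirac mass, the identity map and B = 1, every integral is its integrand and the
    -- perspective is f itself.
    let μ : Measure PUnit.{v + 1} := Measure.dirac PUnit.unit
    have hΦ : IsUnitalField μ fun _ : PUnit.{v + 1} =>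
        PositiveLinearMap.mk₀ (LinearMap.id (R := ℂ) (M := H →L[ℂ] H)) fun _ hx => hx :=
      ⟨fun _ => continuous_const, integrable_const _, by
        rw [integral_dirac]
        rfl⟩
    have hconst : ∀ {X : H →L[ℂ] H}, IsStrictlyPositive X →
        IsStrictlyPositiveField fun _ : PUnit.{v + 1} => X := fun hX =>
      ⟨continuous_const, fun _ => hX⟩
    have key := h PUnit.{v + 1} μ (H →L[ℂ] H) (H →L[ℂ] H) _ _ _ _ hΦ (hconst hA)
      (hconst isStrictlyPositive_one) (hconst hB) (integrable_const _) (integrable_const _)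
      (integrable_const _) (integrable_const _)
    simp only [μ, integral_dirac, perspective_one] at key
    have e : perspective f (arithMean A B) 1 ≤ geomMean (cfc f A) (cfc f B) := key
    rwa [perspective_one] at e
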